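/- Theorem (the 132-bound). Let $w\in S_n$. Define the Schubert polynomial $\mathfrak S_w\in\mathbb Z[x_1,\dots,x_n]$ as follows. For the longest permutation $w_0=n\,(n-1)\cdots 1$ put $\mathfrak S_{w_0}=x_1^{n-1}x_2^{n-2}\cdots x_{n-1}$; for any other $w$ choose $i$ with $w(i)<w(i+1)$ and put $\mathfrak S_w=\partial_i\,\mathfrak S_{ws_i}$, where $\partial_i f=\dfrac{f-s_if}{x_i-x_{i+1}}$ and $s_i=(i,i+1)$ acts on $f$ by exchanging $x_i$ and $x_{i+1}$; the result does not depend on the choices. Let $\nu_w=\mathfrak S_w(1,1,\dots,1)$ and $$\eta_w=\#\{(i,j,k): i<j<k \text{ and } w(i)<w(k)<w(j)\}.$$ Then for every $w\in S_n$, $$\nu_w\ \ge\ \eta_w+1 .$$ -/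

import Mathlib

namespace Schubert

open MvPolynomial Equiv

section DividedDifference

variable {σ : Type*}

theorem X_sub_X_ne_zero {i j : σ} (h : i ≠ j) : (X i - X j : MvPolynomial σ ℤ) ≠ 0 :=
  sub_ne_zero.2 fun e => h (X_injective e)

variable [DecidableEq σ]

/-- Exchange of the variables `x_i` and `x_j` in a polynomial. -/
noncomputable def exchange (i j : σ) (f : MvPolynomial σ ℤ) : MvPolynomial σ ℤ :=
  rename (swap i j) f

theorem sub_dvd_sub_exchange (i j : σ) (f : MvPolynomial σ ℤ) :
    (X i - X j : MvPolynomial σ ℤ) ∣ f - exchange i j f := by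
  rw [← Ideal.mem_span_singleton, ← Ideal.Quotient.mk_eq_mk_iff_sub_mem]
  set I := Ideal.span {(X i - X j : MvPolynomial σ ℤ)}
  have hij : Ideal.Quotient.mkₐ ℤ I (X i) = Ideal.Quotient.mkₐ ℤ I (X j) :=
    (Ideal.Quotient.mk_eq_mk_iff_sub_mem _ _).2 (Ideal.subset_span rfl)
  have h : Ideal.Quotient.mkₐ ℤ I = (Ideal.Quotient.mkₐ ℤ I).comp (rename (swap i j)) := by
    ext k
    simp only [AlgHom.comp_apply, rename_X]
    rcases eq_or_ne k i with rfl | hi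
    · rw [swap_apply_left, hij]
    · rcases eq_or_ne k j with rfl | hj
      · rw [swap_apply_right, hij]
      · rw [swap_apply_of_ne_of_ne hi hj]
  exact DFunLike.congr_fun h f

/-- The divided difference `(f - f(x_i ↔ x_j)) / (x_i - x_j)`, for `i ≠ j`. -/
noncomputable def divDiff (i j : σ) (f : MvPolynomial σ ℤ) : MvPolynomial σ ℤ :=
  (sub_dvd_sub_exchange i j f).choose

theorem mul_divDiff (i j : σ) (f : MvPolynomial σ ℤ) :
    (X i - X j) * divDiff i j f = f - exchange i j f :=
  (sub_dvd_sub_exchange i j f).choose_spec.symm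

theorem divDiff_symm {i j : σ} (h : i ≠ j) (f : MvPolynomial σ ℤ) :
    divDiff j i f = - divDiff i j f := by
  apply mul_left_cancel₀ (X_sub_X_ne_zero h)
  have h1 := mul_divDiff i j f
  have h2 := mul_divDiff j i f
  rw [exchange, swap_comm, ← exchange] at h2
  linear_combination h1 - h2

theorem divDiff_neg {i j : σ} (h : i ≠ j) (f : MvPolynomial σ ℤ) :
    divDiff i j (-f) = - divDiff i j f := by
  apply mul_left_cancel₀ (X_sub_X_ne_zero h)
  have h1 := mul_divDiff i j f
  have h2 := mul_divDiff i j (-f)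
  simp only [exchange, map_neg] at h1 h2
  linear_combination h1 + h2

theorem divDiff_comm {i j k l : σ} (hij : i ≠ j) (hkl : k ≠ l) (hik : i ≠ k) (hil : i ≠ l)
    (hjk : j ≠ k) (hjl : j ≠ l) (f : MvPolynomial σ ℤ) :
    divDiff i j (divDiff k l f) = divDiff k l (divDiff i j f) := by
  apply mul_left_cancel₀ (mul_ne_zero (X_sub_X_ne_zero hij) (X_sub_X_ne_zero hkl))
  have h1 := mul_divDiff i j f
  have h2 := mul_divDiff k l f
  have h3 := mul_divDiff i j (divDiff k l f)
  have h4 := mul_divDiff k l (divDiff i j f)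
  have h5 := congrArg (rename (swap i j)) h2
  have h6 := congrArg (rename (swap k l)) h1
  have hc : rename (swap k l) (rename (swap i j) f) = rename (swap i j) (rename (swap k l) f) := by
    rw [rename_rename, rename_rename]
    congr 2
    ext x
    simp only [Function.comp_apply, swap_apply_def]
    grind
  simp only [exchange, map_mul, map_sub, rename_X, swap_apply_of_ne_of_ne hik.symm hjk.symm,
    swap_apply_of_ne_of_ne hil.symm hjl.symm, swap_apply_of_ne_of_ne hik hil,
    swap_apply_of_ne_of_ne hjk hjl] at *
  linear_combination (X k - X l) * h3 + h2 - h5 - (X i - X j) * h4 - h1 + h6 - hc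

theorem mul_divDiff_three {a b c : σ} (hab : a ≠ b) (hac : a ≠ c) (hbc : b ≠ c)
    (f : MvPolynomial σ ℤ) :
    (X a - X b) * (X a - X c) * (X b - X c) * divDiff a b (divDiff b c (divDiff a b f)) =
      f - rename (swap a b) f - rename (swap b c) f
        + rename (swap b c) (rename (swap a b) f) + rename (swap a b) (rename (swap b c) f)
        - rename (swap a c) f := by
  have h1 := mul_divDiff a b f
  have h2 := mul_divDiff b c (divDiff a b f)
  have h3 := mul_divDiff a b (divDiff b c (divDiff a b f))
  set g1 := divDiff a b f
  set g2 := divDiff b c g1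
  have k1 := congrArg (rename (swap a b)) h1
  have k2 := congrArg (rename (swap b c)) h1
  have k3 := congrArg (rename (swap a b)) k2
  have k4 := congrArg (rename (swap a b)) h2
  have hb : rename (swap a b) (rename (swap b c) (rename (swap a b) f)) =
      rename (swap a c) f := by
    rw [rename_rename, rename_rename]
    congr 2
    ext x
    simp only [Function.comp_apply, swap_apply_def]
    grind
  have hs : rename (swap a b) (rename (swap a b) f) = f := by
    rw [rename_rename]
    have : (swap a b : σ → σ) ∘ swap a b = id := by ext x; simp
    rw [this, rename_id_apply]
  have e1 : swap a b c = c := swap_apply_of_ne_of_ne hac.symm hbc.symm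
  have e2 : swap b c a = a := swap_apply_of_ne_of_ne hab hac
  simp only [exchange, map_mul, map_sub, rename_X, swap_apply_left, swap_apply_right, e1, e2,
    hs, hb] at *
  have hg : rename (swap a b) g1 = g1 := by
    apply mul_left_cancel₀ (X_sub_X_ne_zero hab)
    linear_combination - k1 - h1
  rw [hg] at k4
  linear_combination (X a - X c) * (X b - X c) * h3 + (X a - X c) * h2 - (X b - X c) * k4
    + h1 - k2 + k3

theorem divDiff_braid {a b c : σ} (hab : a ≠ b) (hac : a ≠ c) (hbc : b ≠ c)
    (f : MvPolynomial σ ℤ) :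
    divDiff a b (divDiff b c (divDiff a b f)) = divDiff b c (divDiff a b (divDiff b c f)) := by
  apply mul_left_cancel₀ (mul_ne_zero (mul_ne_zero (X_sub_X_ne_zero hab) (X_sub_X_ne_zero hac))
    (X_sub_X_ne_zero hbc))
  have h1 := mul_divDiff_three hab hac hbc f
  have h2 := mul_divDiff_three hbc.symm hac.symm hab.symm f
  rw [divDiff_symm hbc, divDiff_symm hab, divDiff_symm hbc, divDiff_neg hab, divDiff_neg hbc,
    divDiff_neg hbc, swap_comm c b, swap_comm b a, swap_comm c a] at h2
  linear_combination h1 - h2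

end DividedDifference

section SchubertPolynomial

variable {n : ℕ}

/-- `IsAscent w i j`: the position `j` is the successor of `i`, and `w i < w j`. -/
def IsAscent (w : Perm (Fin n)) (i j : Fin n) : Prop :=
  (i : ℕ) + 1 = j ∧ w i < w j

theorem exists_isAscent {w : Perm (Fin n)} (hw : w ≠ Fin.revPerm) :
    ∃ p : Fin n × Fin n, IsAscent w p.1 p.2 := by
  by_contra! h
  apply hw
  have hanti : StrictAnti w := by
    rcases n with _ | m
    · exact fun a => a.elim0
    · rw [Fin.strictAnti_iff_succ_lt]
      intro i
      have h1 : ¬ w i.castSucc < w i.succ := fun h2 => h (i.castSucc, i.succ) ⟨by simp, h2⟩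
      exact lt_of_le_of_ne (not_lt.1 h1) (w.injective.ne (Fin.castSucc_lt_succ).ne')
  have hmono : StrictMono (fun i => (w i).rev) := fun a b hab => Fin.rev_lt_rev.2 (hanti hab)
  have := (StrictMono.range_inj hmono strictMono_id).1
    (by rw [Set.range_id]; exact (Fin.revPerm.surjective.comp w.surjective).range_eq)
  ext i : 1
  have hi := congrFun this i
  simp only [id] at hi
  rw [Fin.revPerm_apply, ← Fin.rev_eq_iff, hi]

/-- The number of non-inversions of `w`. -/
def nonInv (w : Perm (Fin n)) : ℕ :=
  (Finset.univ.filter fun p : Fin n × Fin n => p.1 < p.2 ∧ w p.1 < w p.2).card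

theorem nonInv_lt {w : Perm (Fin n)} {i j : Fin n} (h : IsAscent w i j) :
    nonInv (w * swap i j) < nonInv w := by
  obtain ⟨hij, hw⟩ := h
  have hlt : i < j := by rw [Fin.lt_def]; omega
  unfold nonInv
  rw [← Finset.card_image_of_injective _ ((swap i j).injective.prodMap (swap i j).injective)]
  refine Finset.card_lt_card ((Finset.ssubset_iff_of_subset ?_).2 ⟨(i, j), ?_, ?_⟩)
  · intro q hq
    obtain ⟨⟨a, b⟩, hab, rfl⟩ := Finset.mem_image.1 hq
    replace hab := (Finset.mem_filter.1 hab).2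
    simp only [Finset.mem_filter, Finset.mem_univ, true_and, Perm.mul_apply, Prod.map] at hab ⊢
    refine ⟨?_, hab.2⟩
    obtain ⟨h1, h2⟩ := hab
    have h3 : ¬ (a = i ∧ b = j) := by
      rintro ⟨rfl, rfl⟩
      simp only [swap_apply_left, swap_apply_right] at h2
      exact absurd h2 hw.not_gt
    clear h2 hw hq
    simp only [swap_apply_def]
    split_ifs <;> grind
  · simp [hlt, hw]
  · intro hq
    obtain ⟨⟨a, b⟩, hab, he⟩ := Finset.mem_image.1 hq
    replace hab := (Finset.mem_filter.1 hab).2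
    simp only [Prod.map, Prod.mk.injEq] at hab he
    rw [swap_apply_eq_iff, swap_apply_eq_iff, swap_apply_left, swap_apply_right] at he
    obtain ⟨rfl, rfl⟩ := he
    exact absurd hab.1 hlt.not_gt

/-- The Schubert polynomial of `w`: it is `x_1^(n-1) x_2^(n-2) ⋯ x_(n-1)` for the longest
permutation `w₀`, and `∂_i 𝔖_(w s_i)` for any other `w`, where `i` is some ascent of `w`
(`schubert_of_isAscent`: the choice does not matter). Positions are counted from `0`. -/
noncomputable def schubert (w : Perm (Fin n)) : MvPolynomial (Fin n) ℤ :=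
  open Classical in
  if hw : w = Fin.revPerm then ∏ i : Fin n, X i ^ (n - 1 - (i : ℕ))
  else
    let p := (exists_isAscent hw).choose
    divDiff p.1 p.2 (schubert (w * swap p.1 p.2))
termination_by nonInv w
decreasing_by exact nonInv_lt (exists_isAscent hw).choose_spec

theorem schubert_revPerm :
    schubert (Fin.revPerm : Perm (Fin n)) = ∏ i : Fin n, X i ^ (n - 1 - (i : ℕ)) := by
  rw [schubert, dif_pos rfl]

theorem isAscent_ne {w : Perm (Fin n)} {i j : Fin n} (h : IsAscent w i j) : i ≠ j := by
  rintro rfl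
  exact absurd h.2 (lt_irrefl _)

theorem divDiff_schubert_eq {w : Perm (Fin n)}
    (ih : ∀ v : Perm (Fin n), nonInv v < nonInv w → ∀ i j, IsAscent v i j →
      schubert v = divDiff i j (schubert (v * swap i j)))
    {i j k l : Fin n} (h1 : IsAscent w i j) (h2 : IsAscent w k l) (hik : i < k) :
    divDiff i j (schubert (w * swap i j)) = divDiff k l (schubert (w * swap k l)) := by
  have hij := isAscent_ne h1
  have hkl := isAscent_ne h2
  have m1 := nonInv_lt h1
  have m2 := nonInv_lt h2
  obtain ⟨e1, w1⟩ := h1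
  obtain ⟨e2, w2⟩ := h2
  rw [Fin.lt_def] at hik
  have hil : i ≠ l := by intro h; subst h; omega
  have hjl : j ≠ l := by intro h; subst h; omega
  have hik' : i ≠ k := by intro h; subst h; omega
  by_cases hjk : j = k
  · subst hjk
    have a1 : IsAscent (w * swap i j) j l := by
      refine ⟨e2, ?_⟩
      simp only [Perm.mul_apply, swap_apply_right, swap_apply_of_ne_of_ne hil.symm hjl.symm]
      exact w1.trans w2
    have a2 : IsAscent (w * swap i j * swap j l) i j := by
      refine ⟨e1, ?_⟩
      simp only [Perm.mul_apply, swap_apply_left, swap_apply_of_ne_of_ne hij hil,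
        swap_apply_of_ne_of_ne hil.symm hjl.symm]
      exact w2
    have b1 : IsAscent (w * swap j l) i j := by
      refine ⟨e1, ?_⟩
      simp only [Perm.mul_apply, swap_apply_left, swap_apply_of_ne_of_ne hij hil]
      exact w1.trans w2
    have b2 : IsAscent (w * swap j l * swap i j) j l := by
      refine ⟨e2, ?_⟩
      simp only [Perm.mul_apply, swap_apply_right, swap_apply_of_ne_of_ne hij hil,
        swap_apply_of_ne_of_ne hil.symm hjl.symm]
      exact w1
    rw [ih _ m1 _ _ a1, ih _ ((nonInv_lt a1).trans m1) _ _ a2, ih _ m2 _ _ b1,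
      ih _ ((nonInv_lt b1).trans m2) _ _ b2, divDiff_braid hij hil hjl]
    have : w * swap i j * swap j l * swap i j = w * swap j l * swap i j * swap j l := by
      ext x : 1
      simp only [Perm.mul_apply, swap_apply_def]
      congr 1
      grind
    rw [this]
  · have a1 : IsAscent (w * swap i j) k l := by
      refine ⟨e2, ?_⟩
      simp only [Perm.mul_apply, swap_apply_of_ne_of_ne hil.symm hjl.symm,
        swap_apply_of_ne_of_ne hik'.symm (Ne.symm hjk)]
      exact w2
    have b1 : IsAscent (w * swap k l) i j := by
      refine ⟨e1, ?_⟩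
      simp only [Perm.mul_apply, swap_apply_of_ne_of_ne hik' hil, swap_apply_of_ne_of_ne hjk hjl]
      exact w1
    rw [ih _ m1 _ _ a1, ih _ m2 _ _ b1, divDiff_comm hij hkl hik' hil hjk hjl]
    have : w * swap i j * swap k l = w * swap k l * swap i j := by
      ext x : 1
      simp only [Perm.mul_apply, swap_apply_def]
      congr 1
      grind
    rw [this]

/-- The recursion holds for every ascent, so `schubert` does not depend on a choice of ascents. -/
theorem schubert_of_isAscent (w : Perm (Fin n)) (i j : Fin n) (h : IsAscent w i j) :
    schubert w = divDiff i j (schubert (w * swap i j)) := by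
  induction hm : nonInv w using Nat.strong_induction_on generalizing w i j with
  | _ m ih =>
    subst hm
    have ih' : ∀ v : Perm (Fin n), nonInv v < nonInv w → ∀ i j, IsAscent v i j →
        schubert v = divDiff i j (schubert (v * swap i j)) :=
      fun v hv i j hij => ih _ hv v i j hij rfl
    have hw : w ≠ Fin.revPerm := by
      rintro rfl
      have h1 := h.2
      rw [Fin.revPerm_apply, Fin.revPerm_apply, Fin.rev_lt_rev, Fin.lt_def] at h1
      have h2 := h.1
      omega
    rw [schubert, dif_neg hw]
    have hc := (exists_isAscent hw).choose_spec
    generalize (exists_isAscent hw).choose = p at hc ⊢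
    obtain ⟨k, l⟩ := p
    dsimp only at hc ⊢
    rcases lt_trichotomy i k with hlt | rfl | hlt
    · exact (divDiff_schubert_eq ih' h hc hlt).symm
    · have : j = l := Fin.ext (h.1.symm.trans hc.1)
      rw [this]
    · exact divDiff_schubert_eq ih' hc h hlt

end SchubertPolynomial

section Statistics

variable {n : ℕ}

/-- The principal specialization `ν_w = 𝔖_w(1, …, 1)`. -/
noncomputable def nu (w : Perm (Fin n)) : ℤ :=
  MvPolynomial.eval (fun _ => 1) (schubert w)

/-- The occurrences of the pattern `132` in `w`. -/
def patterns132 (w : Perm (Fin n)) : Finset (Fin n × Fin n × Fin n) :=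
  Finset.univ.filter fun (i, j, k) => i < j ∧ j < k ∧ w i < w k ∧ w k < w j

/-- The number `η_w` of occurrences of the pattern `132` in `w`. -/
def eta (w : Perm (Fin n)) : ℕ :=
  (patterns132 w).card

end Statistics

end Schubert

namespace Schubert

open MvPolynomial Equiv

/-! ### Twisted Leibniz rules for divided differences. -/

section DividedDifference

variable {σ : Type*} [DecidableEq σ]

/-! If w ≠ w₀, let i be the first position with a larger entry somewhere on its right. Earlier
entries then exceed everything to their right, so Monk's rule for x_i 𝔖_w loses its negative terms:
x_i 𝔖_w = ∑ 𝔖_(w t_ij), over the j > i for which w t_ij covers w in the Bruhat order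
(`X_mul_schubert`). At x = 1 this reads ν_w = ∑ ν_(w t_ij).

It remains to see that η + 1 is subadditive along the same recurrence (`eta_add_one_le_sum`), for
which at most two covers are needed. Let m be the position of the value next above w i. Passing to w
t_im destroys only the patterns (i, p, m). If there are any, let j be the least such p: in w t_ij
the small value w i sits at j, so (j, p, m) is a pattern for each other p, and the 1 in η + 1 pays
for p = j. Induction from w₀, where ν = 1 and η = 0, concludes. -/

theorem divDiff_eq_of_mul_eq {i j : σ} (h : i ≠ j) {f g : MvPolynomial σ ℤ}
    (hg : (X i - X j) * g = f - exchange i j f) : divDiff i j f = g :=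
  mul_left_cancel₀ (X_sub_X_ne_zero h) ((mul_divDiff i j f).trans hg.symm)

theorem exchange_divDiff {i j : σ} (h : i ≠ j) (f : MvPolynomial σ ℤ) :
    exchange i j (divDiff i j f) = divDiff i j f := by
  apply mul_left_cancel₀ (X_sub_X_ne_zero h)
  have h1 := mul_divDiff i j f
  have h2 := congrArg (exchange i j) h1
  have hs : exchange i j (exchange i j f) = f := by
    have : (swap i j : σ → σ) ∘ swap i j = id := by ext x; simp
    rw [exchange, exchange, rename_rename, this, rename_id_apply]
  unfold exchange at *
  simp only [map_mul, map_sub, rename_X, swap_apply_left, swap_apply_right, hs] at h2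
  linear_combination - h1 - h2

theorem divDiff_divDiff {i j : σ} (h : i ≠ j) (f : MvPolynomial σ ℤ) :
    divDiff i j (divDiff i j f) = 0 :=
  divDiff_eq_of_mul_eq h (by rw [exchange_divDiff h, sub_self, mul_zero])

theorem divDiff_sum {ι : Type*} {i j : σ} (h : i ≠ j) (s : Finset ι) (f : ι → MvPolynomial σ ℤ) :
    divDiff i j (∑ a ∈ s, f a) = ∑ a ∈ s, divDiff i j (f a) := by
  apply divDiff_eq_of_mul_eq h
  rw [Finset.mul_sum, exchange, map_sum, ← Finset.sum_sub_distrib]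
  exact Finset.sum_congr rfl fun a _ => mul_divDiff i j (f a)

theorem divDiff_mul_of_exchange_eq {i j : σ} (h : i ≠ j) {g : MvPolynomial σ ℤ}
    (hg : exchange i j g = g) (f : MvPolynomial σ ℤ) :
    divDiff i j (g * f) = g * divDiff i j f := by
  apply divDiff_eq_of_mul_eq h
  have h1 := mul_divDiff i j f
  unfold exchange at *
  rw [map_mul, hg]
  linear_combination g * h1

/-- Twisted Leibniz rule, with ∂(x_j) = -1. It turns x_i ∂f into f + ∂(x_j f), moving the recurrence
from position i to i + 1. -/
theorem divDiff_X_mul {i j : σ} (h : i ≠ j) (f : MvPolynomial σ ℤ) :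
    divDiff i j (X j * f) = X i * divDiff i j f - f := by
  apply divDiff_eq_of_mul_eq h
  have h1 := mul_divDiff i j f
  simp only [exchange, map_mul, rename_X, swap_apply_right] at *
  linear_combination X i * h1

end DividedDifference

/-! ### The cotransition recurrence for Schubert polynomials. -/

section Cotransition

variable {n : ℕ}

theorem divDiff_schubert_of_isAscent {w : Perm (Fin n)} {i j : Fin n} (h : IsAscent w i j) :
    divDiff i j (schubert w) = 0 := by
  rw [schubert_of_isAscent w i j h, divDiff_divDiff (isAscent_ne h)]

theorem divDiff_schubert_of_descent {w : Perm (Fin n)} {i j : Fin n} (hij : (i : ℕ) + 1 = j)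
    (h : w j < w i) : divDiff i j (schubert w) = schubert (w * swap i j) := by
  rw [schubert_of_isAscent (w * swap i j) i j ⟨hij, by simpa using h⟩, mul_assoc, swap_mul_self,
    mul_one]

theorem divDiff_schubert (w : Perm (Fin n)) {i j : Fin n} (hij : (i : ℕ) + 1 = j) :
    divDiff i j (schubert w) = if w j < w i then schubert (w * swap i j) else 0 := by
  split_ifs with h
  · exact divDiff_schubert_of_descent hij h
  · refine divDiff_schubert_of_isAscent ⟨hij, lt_of_le_of_ne (not_lt.1 h) (w.injective.ne ?_)⟩
    rintro rfl
    omega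

/-- The positions `j > i` such that `w * swap i j` covers `w` in the Bruhat order. -/
def upperCovers (w : Perm (Fin n)) (i : Fin n) : Finset (Fin n) :=
  Finset.univ.filter fun j => i < j ∧ w i < w j ∧ ∀ l, i < l → l < j → ¬ (w i < w l ∧ w l < w j)

theorem mem_upperCovers {w : Perm (Fin n)} {i j : Fin n} :
    j ∈ upperCovers w i ↔
      i < j ∧ w i < w j ∧ ∀ l, i < l → l < j → ¬ (w i < w l ∧ w l < w j) := by
  simp [upperCovers]

/-- Each of the entries of `w` before position `i` exceeds all entries on its right. -/
def DominatesBefore (w : Perm (Fin n)) (i : Fin n) : Prop :=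
  ∀ q < i, ∀ l, q < l → w l < w q

/-- The exponents of x_i and x_j differ by one, so 𝔖_(w₀) is x_i times a polynomial symmetric in x_i
and x_j, and ∂(x_i) = 1. -/
theorem X_mul_divDiff_schubert_revPerm {i j : Fin n} (hij : (i : ℕ) + 1 = j) :
    X i * divDiff i j (schubert (Fin.revPerm : Perm (Fin n))) = schubert Fin.revPerm := by
  have hne : i ≠ j := by rintro rfl; omega
  have hj := j.isLt
  set R : MvPolynomial (Fin n) ℤ :=
    ∏ k ∈ (Finset.univ.erase i).erase j, X k ^ (n - 1 - (k : ℕ)) with hR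
  have hS : schubert (Fin.revPerm : Perm (Fin n)) = (R * (X i * X j) ^ (n - 1 - (j : ℕ))) * X i := by
    rw [schubert_revPerm, ← Finset.mul_prod_erase _ _ (Finset.mem_univ i),
      ← Finset.mul_prod_erase _ _ (Finset.mem_erase.2 ⟨hne.symm, Finset.mem_univ j⟩), ← hR,
      show n - 1 - (i : ℕ) = n - 1 - (j : ℕ) + 1 by omega]
    ring
  have hRe : exchange i j R = R := by
    rw [exchange, hR, map_prod]
    refine Finset.prod_congr rfl fun k hk => ?_
    simp only [Finset.mem_erase] at hk
    rw [map_pow, rename_X, swap_apply_of_ne_of_ne hk.2.1 hk.1]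
  have he : exchange i j (R * (X i * X j) ^ (n - 1 - (j : ℕ))) =
      R * (X i * X j) ^ (n - 1 - (j : ℕ)) := by
    unfold exchange at *
    rw [map_mul, hRe, map_pow, map_mul, rename_X, rename_X, swap_apply_left, swap_apply_right,
      mul_comm (X j)]
  have h1 : divDiff i j (X i : MvPolynomial (Fin n) ℤ) = 1 :=
    divDiff_eq_of_mul_eq hne (by simp [exchange])
  rw [hS, divDiff_mul_of_exchange_eq hne he, h1]
  ring

/-- This tells which terms survive when ∂_k is applied to the recurrence for w s_k: the term of
index s_k(j) is 𝔖_(w t_ij s_k), which ∂_k sends to 𝔖_(w t_ij) if w t_ij ascends at k, and kills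
otherwise. -/
theorem upperCovers_mul_swap_of_isAscent {w : Perm (Fin n)} {i k l : Fin n} (h : IsAscent w k l)
    (hik : i < k) (j : Fin n) :
    j ∈ upperCovers w i ↔ swap k l j ∈ upperCovers (w * swap k l) i ∧
      (w * swap i j) k < (w * swap i j) l := by
  obtain ⟨hkl, hw⟩ := h
  have hlt : k < l := by rw [Fin.lt_def]; omega
  have hl : ∀ x, x < l ↔ x ≤ k := fun x => by rw [Fin.lt_def, Fin.le_def]; omega
  have hs : ∀ x, x ≠ k → x ≠ l → swap k l x = x := fun x => swap_apply_of_ne_of_ne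
  have hil := hik.trans hlt
  simp only [mem_upperCovers, Perm.mul_apply, swap_apply_self, hs i hik.ne hil.ne]
  by_cases hjk : j = k
  · subst hjk
    rw [swap_apply_left, swap_apply_right, swap_apply_of_ne_of_ne hil.ne' hlt.ne']
    constructor
    · rintro ⟨h1, h2, h3⟩
      refine ⟨⟨hil, h2, fun x h4 h5 => ?_⟩, h2.trans hw⟩
      rcases ((hl x).1 h5).lt_or_eq with h6 | rfl
      · rw [hs x h6.ne h5.ne]
        exact h3 x h4 h6
      · rw [swap_apply_left]
        exact fun h => absurd hw h.2.not_gt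
    · rintro ⟨⟨-, h2, h3⟩, -⟩
      refine ⟨hik, h2, fun x h4 h5 => ?_⟩
      have := h3 x h4 (h5.trans hlt)
      rwa [hs x h5.ne (h5.trans hlt).ne] at this
  · by_cases hjl : j = l
    · subst hjl
      rw [swap_apply_right, swap_apply_right, swap_apply_of_ne_of_ne hik.ne' hlt.ne]
      constructor
      · rintro ⟨h1, h2, h3⟩
        refine ⟨⟨hik, h2, fun x h4 h5 => ?_⟩, ?_⟩
        · rw [hs x h5.ne (h5.trans hlt).ne]
          exact h3 x h4 (h5.trans hlt)
        · exact lt_of_le_of_ne (not_lt.1 fun h => h3 k hik hlt ⟨h, hw⟩) (w.injective.ne hik.ne')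
      · rintro ⟨⟨-, h2, h3⟩, h6⟩
        refine ⟨hil, h2, fun x h4 h5 => ?_⟩
        rcases ((hl x).1 h5).lt_or_eq with h7 | rfl
        · have := h3 x h4 h7
          rwa [hs x h7.ne h5.ne] at this
        · exact fun h => absurd h6 h.1.not_gt
    · rw [hs j hjk hjl, swap_apply_of_ne_of_ne hik.ne' (Ne.symm hjk),
        swap_apply_of_ne_of_ne hil.ne' (Ne.symm hjl)]
      -- As j is neither k nor l, the positions strictly between i and j are permuted by s_k.
      have hj : ∀ x, i < x ∧ x < j ↔ i < swap k l x ∧ swap k l x < j := by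
        intro x
        have := hl j
        rw [swap_apply_def]
        split_ifs with h1 h2
        · subst h1; grind
        · subst h2; grind
        · rfl
      constructor
      · rintro ⟨h1, h2, h3⟩
        refine ⟨⟨h1, h2, fun x h4 h5 => ?_⟩, hw⟩
        have := (hj x).1 ⟨h4, h5⟩
        exact h3 _ this.1 this.2
      · rintro ⟨⟨h1, h2, h3⟩, -⟩
        refine ⟨h1, h2, fun x h4 h5 => ?_⟩
        have h6 := (hj x).1 ⟨h4, h5⟩
        have := h3 _ h6.1 h6.2
        rwa [swap_apply_self] at this

/-- The cotransition recurrence: Monk's rule for `x_i 𝔖_w` when the entries before position `i`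
contribute no term. -/
theorem X_mul_schubert (w : Perm (Fin n)) (i : Fin n) (hw : DominatesBefore w i)
    (hi : ∃ l, i < l ∧ w i < w l) :
    X i * schubert w = ∑ j ∈ upperCovers w i, schubert (w * swap i j) := by
  induction hm : nonInv w using Nat.strong_induction_on generalizing w i with
  | _ m ih =>
    subst hm
    by_cases hasc : ∃ k l, IsAscent w k l ∧ i < k
    -- With an ascent beyond i, apply ∂_k to the recurrence for w s_k; x_i is fixed by s_k and
    -- passes through ∂_k.
    · obtain ⟨k, l, hkl, hik⟩ := hasc
      have hk := hkl.1
      have hne := isAscent_ne hkl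
      have hil : i < l := by rw [Fin.lt_def] at *; omega
      have hsi : swap k l i = i := swap_apply_of_ne_of_ne hik.ne hil.ne
      have hlt : ∀ q x, q ≤ i → q < x → q < swap k l x := by
        intro q x hq hx
        rw [swap_apply_def]
        split_ifs
        · exact hq.trans_lt hil
        · exact hq.trans_lt hik
        · exact hx
      have ih1 := ih _ (nonInv_lt hkl) (w * swap k l) i (by
          intro q hq x hx
          have : swap k l q = q := swap_apply_of_ne_of_ne (hq.trans hik).ne (hq.trans hil).ne
          rw [Perm.mul_apply, Perm.mul_apply, this]
          exact hw q hq _ (hlt _ _ hq.le hx))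
        (by
          obtain ⟨x, hx, hx'⟩ := hi
          exact ⟨swap k l x, hlt _ _ le_rfl hx, by simpa [hsi] using hx'⟩) rfl
      rw [schubert_of_isAscent w k l hkl, ← divDiff_mul_of_exchange_eq hne
        (by rw [exchange, rename_X, hsi]), ih1, divDiff_sum hne]
      have hcomm : ∀ j, w * swap k l * swap i (swap k l j) * swap k l = w * swap i j := by
        intro j
        have := Equiv.swap_apply_apply (swap k l) i j
        rw [hsi] at this
        rw [this, swap_inv]
        simp [mul_assoc]
      rw [← Finset.sum_filter_add_sum_filter_not (upperCovers (w * swap k l) i)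
        (fun j => (w * swap i (swap k l j)) k < (w * swap i (swap k l j)) l),
        Finset.sum_eq_zero (s := Finset.filter (fun j => ¬ _) _), add_zero]
      · symm
        refine Finset.sum_nbij' (swap k l) (swap k l) ?_ ?_ ?_ ?_ ?_
        · intro j hj
          rw [upperCovers_mul_swap_of_isAscent hkl hik] at hj
          rw [Finset.mem_filter, swap_apply_self]
          exact hj
        · intro j hj
          rw [upperCovers_mul_swap_of_isAscent hkl hik, swap_apply_self]
          exact Finset.mem_filter.1 hj
        · simp
        · simp
        · intro j hj
          have hj' := ((upperCovers_mul_swap_of_isAscent hkl hik j).1 hj).2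
          rw [← hcomm j] at hj' ⊢
          rw [divDiff_schubert_of_descent hk]
          simpa using hj'
      · intro j hj
        have hj' := (Finset.mem_filter.1 hj).2
        rw [← hcomm (swap k l j)] at hj'
        simp only [Perm.mul_apply, swap_apply_left, swap_apply_right, swap_apply_self] at hj'
        rw [divDiff_schubert _ hk, if_neg]
        simpa using hj'
    -- Otherwise w decreases after i, so i itself is an ascent. The recurrence is then taken for w
    -- s_i at position j = i + 1.
    · push Not at hasc
      have hanti : ∀ k l, i < k → k < l → w l < w k := by
        suffices h : StrictAntiOn w (Set.Ioi i) from fun k l hk hl => h hk (hk.trans hl) hl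
        rcases n with _ | n
        · exact i.elim0
        refine strictAntiOn_of_succ_lt Set.ordConnected_Ioi fun a ha hai _ => ?_
        have hs : (a : ℕ) + 1 = Order.succ a := by
          have hlast : a ≠ Fin.last n := fun h => ha (h ▸ fun x _ => Fin.le_last x)
          obtain ⟨b, rfl⟩ := Fin.exists_castSucc_eq.2 hlast
          simp
        refine lt_of_le_of_ne (not_lt.1 fun h => ?_)
          (w.injective.ne (Order.lt_succ_of_not_isMax ha).ne')
        exact absurd (hasc a _ ⟨hs, h⟩) (not_le.2 hai)
      obtain ⟨l, hl, hil⟩ := hi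
      obtain ⟨j, hj⟩ : ∃ j : Fin n, (i : ℕ) + 1 = j := ⟨⟨i + 1, by rw [Fin.lt_def] at hl; omega⟩, rfl⟩
      have hij : i < j := by rw [Fin.lt_def]; omega
      have hjl : ∀ x, i < x → x ≠ j → j < x := fun x hx hne => by
        rw [Fin.lt_def] at *; have := Fin.val_ne_of_ne hne; omega
      have hA : IsAscent w i j := ⟨hj, by
        by_cases h : l = j
        · exact h ▸ hil
        · exact hil.trans (hanti j l hij (hjl l hl h))⟩
      have hdom : DominatesBefore (w * swap i j) j := by
        intro q hq x hx
        simp only [Perm.mul_apply]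
        have hqi : q ≤ i := by rw [Fin.le_def]; rw [Fin.lt_def] at hq; omega
        rcases hqi.lt_or_eq with hqi | rfl
        · rw [swap_apply_of_ne_of_ne hqi.ne hq.ne]
          refine hw q hqi _ ?_
          rw [swap_apply_def]
          split_ifs <;> order
        · rw [swap_apply_left]
          by_cases hxj : x = j
          · rw [hxj, swap_apply_right]
            exact hA.2
          · rw [swap_apply_of_ne_of_ne hx.ne' hxj]
            exact hanti j x hij (hjl x hx hxj)
      have hd : X i * schubert w = schubert (w * swap i j) +
          divDiff i j (X j * schubert (w * swap i j)) := by
        rw [divDiff_X_mul hij.ne, ← schubert_of_isAscent w i j hA]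
        ring
      -- The cover at j accounts for the summand 𝔖_(w s_i) of `hd`; the others come from ∂_i applied
      -- to x_j 𝔖_(w s_i).
      have hcov : upperCovers w i = insert j (upperCovers (w * swap i j) j) := by
        ext x
        have hs : ∀ y, j < y → swap i j y = y := fun y hy =>
          swap_apply_of_ne_of_ne (hij.trans hy).ne' hy.ne'
        have hlt := hA.2
        simp only [Finset.mem_insert, mem_upperCovers, Perm.mul_apply, swap_apply_right]
        constructor
        · rintro ⟨h1, h2, h3⟩
          refine or_iff_not_imp_left.2 fun hx => ?_
          have hjx := hjl x h1 hx
          refine ⟨hjx, by rwa [hs x hjx], fun y h4 h5 => ?_⟩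
          rw [hs x hjx, hs y h4]
          exact h3 y (hij.trans h4) h5
        · rintro (rfl | ⟨h1, h2, h3⟩)
          · refine ⟨hij, hlt, fun y h4 h5 => absurd (hjl y h4 h5.ne) h5.not_gt⟩
          · rw [hs x h1] at h2 h3
            refine ⟨hij.trans h1, h2, fun y h4 h5 h6 => ?_⟩
            by_cases hy : y = j
            · exact absurd (hanti j x hij h1) (hy ▸ h6.2).not_gt
            · have := h3 y (hjl y h4 hy) h5
              rw [hs y (hjl y h4 hy)] at this
              exact this h6
      have hnot : j ∉ upperCovers (w * swap i j) j := by simp [mem_upperCovers]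
      rw [hcov, Finset.sum_insert hnot]
      by_cases hex : ∃ x, j < x ∧ w i < w x
      · rw [hd, ih _ (nonInv_lt hA) (w * swap i j) j hdom (by
          obtain ⟨x, hx, hx'⟩ := hex
          refine ⟨x, hx, ?_⟩
          simpa [swap_apply_of_ne_of_ne (hij.trans hx).ne' hx.ne'] using hx') rfl,
          divDiff_sum hij.ne]
        congr 1
        refine Finset.sum_congr rfl fun x hx => ?_
        have hx1 := (mem_upperCovers.1 hx).1
        have hxi := (hij.trans hx1).ne'
        rw [divDiff_schubert_of_descent hj]
        · congr 1
          have := Equiv.swap_apply_apply (swap i j) j x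
          rw [swap_apply_right, swap_apply_of_ne_of_ne hxi hx1.ne'] at this
          rw [this, swap_inv]
          simp [mul_assoc]
        · simp only [Perm.mul_apply, swap_apply_left,
            swap_apply_of_ne_of_ne hxi hx1.ne', swap_apply_of_ne_of_ne hij.ne (hij.trans hx1).ne]
          exact hanti j x hij hx1
      · push Not at hex
        -- No larger entry remains to the right of j in w s_i, so induction does not apply; but then
        -- w s_i has no ascent at all.
        have hrev : w * swap i j = Fin.revPerm := by
          by_contra hne
          obtain ⟨⟨a, b⟩, hab, hlt⟩ := exists_isAscent hne
          dsimp only at hab hlt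
          have hab' : a < b := by rw [Fin.lt_def]; omega
          rcases lt_trichotomy a j with h | rfl | h
          · exact absurd hlt (hdom a h b hab').not_gt
          · refine absurd hlt (not_lt.2 ?_)
            simpa [swap_apply_of_ne_of_ne (hij.trans hab').ne' hab'.ne'] using hex b hab'
          · refine absurd hlt (not_lt.2 ?_)
            simpa [swap_apply_of_ne_of_ne (hij.trans h).ne' h.ne',
              swap_apply_of_ne_of_ne (hij.trans (h.trans hab')).ne' (h.trans hab').ne']
              using (hanti a b (hij.trans h) hab').le
        rw [schubert_of_isAscent w i j hA, hrev, X_mul_divDiff_schubert_revPerm hj,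
          Finset.sum_eq_zero, add_zero]
        intro x hx
        have hx1 := mem_upperCovers.1 hx
        exfalso
        have h2 := hex x hx1.1
        rw [← hrev] at hx1
        have h3 := hx1.2.1
        simp only [Perm.mul_apply, swap_apply_right,
          swap_apply_of_ne_of_ne (hij.trans hx1.1).ne' hx1.1.ne'] at h3
        exact absurd h3 h2.not_gt

end Cotransition

/-! ### Pattern counts along the recurrence. -/

section Bound

variable {n : ℕ}

theorem mem_patterns132 {w : Perm (Fin n)} {x y z : Fin n} :
    (x, y, z) ∈ patterns132 w ↔ x < y ∧ y < z ∧ w x < w z ∧ w z < w y := by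
  simp [patterns132]

theorem nu_eq_sum {w : Perm (Fin n)} {i : Fin n} (hw : DominatesBefore w i)
    (hi : ∃ l, i < l ∧ w i < w l) : nu w = ∑ j ∈ upperCovers w i, nu (w * swap i j) := by
  have := congrArg (eval fun _ => (1 : ℤ)) (X_mul_schubert w i hw hi)
  simpa [nu, map_sum] using this

theorem nu_revPerm : nu (Fin.revPerm : Perm (Fin n)) = 1 := by
  simp [nu, schubert_revPerm, map_prod]

theorem eta_revPerm : eta (Fin.revPerm : Perm (Fin n)) = 0 := by
  rw [eta, Finset.card_eq_zero, Finset.eq_empty_iff_forall_notMem]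
  rintro ⟨x, y, z⟩ h
  obtain ⟨h1, h2, h3, -⟩ := mem_patterns132.1 h
  rw [Fin.revPerm_apply, Fin.revPerm_apply, Fin.rev_lt_rev] at h3
  exact absurd (h1.trans h2) h3.not_gt

/-- Take the least position with a larger entry on its right; minimality says that every earlier
entry dominates. -/
theorem exists_dominatesBefore {w : Perm (Fin n)} (hw : w ≠ Fin.revPerm) :
    ∃ i, DominatesBefore w i ∧ ∃ l, i < l ∧ w i < w l := by
  obtain ⟨⟨a, b⟩, hab, hlt⟩ := exists_isAscent hw
  have hne : (Finset.univ.filter fun i => ∃ l, i < l ∧ w i < w l).Nonempty :=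
    ⟨a, by simpa using ⟨b, by rw [Fin.lt_def]; dsimp only at hab; omega, hlt⟩⟩
  obtain ⟨i, hi, hmin⟩ := Finset.exists_min_image _ id hne
  refine ⟨i, fun q hq l hl => ?_, (Finset.mem_filter.1 hi).2⟩
  by_contra h
  refine absurd (hmin q (Finset.mem_filter.2 ⟨Finset.mem_univ _, l, hl, ?_⟩)) hq.not_ge
  exact lt_of_le_of_ne (not_lt.1 h) (w.injective.ne hl.ne)

/-- Exchanging the entry `w i` with the next larger value, at position `m > i`, destroys only
those `132`-patterns that use both of these entries. -/
theorem eta_le_eta_mul_swap_add {w : Perm (Fin n)} {i m : Fin n} (him : i < m)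
    (hlt : w i < w m) (hadj : ∀ l, ¬ (w i < w l ∧ w l < w m)) :
    eta w ≤ eta (w * swap i m) +
      (Finset.univ.filter fun p => i < p ∧ p < m ∧ w m < w p).card := by
  classical
  refine (Finset.card_le_card (t := patterns132 (w * swap i m) ∪
    (Finset.univ.filter fun p => i < p ∧ p < m ∧ w m < w p).image fun p => (i, p, m)) ?_).trans
    ((Finset.card_union_le _ _).trans (Nat.add_le_add_left Finset.card_image_le _))
  rintro ⟨x, y, z⟩ h
  obtain ⟨h1, h2, h3, h4⟩ := mem_patterns132.1 h
  by_cases hxz : x = i ∧ z = m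
  · obtain ⟨rfl, rfl⟩ := hxz
    exact Finset.mem_union_right _ (Finset.mem_image.2 ⟨y, by simp [h1, h2, h4], rfl⟩)
  · refine Finset.mem_union_left _ (mem_patterns132.2 ⟨h1, h2, ?_⟩)
    -- The values w i and w m are consecutive, so exchanging them reverses no comparison except
    -- their own.
    have key : ∀ u v, w u < w v → ¬ (u = i ∧ v = m) →
        (w * swap i m) u < (w * swap i m) v := by
      intro u v huv hne
      have e1 := hadj u
      have e2 := hadj v
      simp only [Perm.mul_apply, swap_apply_def]
      have := w.injective.ne_iff (x := u) (y := i)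
      have := w.injective.ne_iff (x := v) (y := i)
      have := w.injective.ne_iff (x := u) (y := m)
      have := w.injective.ne_iff (x := v) (y := m)
      split_ifs <;> grind
    refine ⟨key x z h3 hxz, key z y h4 ?_⟩
    rintro ⟨rfl, rfl⟩
    exact absurd h2 him.not_gt

/-- In w t_ij the value w i stands at j, so each counted p other than j gives the pattern (j, p, m);
the extra 1 allows for p = j. -/
theorem card_le_eta_mul_swap_add_one {w : Perm (Fin n)} {i j m : Fin n}
    (hlt : w i < w m) (hmin : ∀ p, i < p → p < m → w m < w p → j ≤ p) :
    (Finset.univ.filter fun p => i < p ∧ p < m ∧ w m < w p).card ≤ eta (w * swap i j) + 1 := by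
  classical
  -- The triple (j, j, j) is never a pattern: it serves as the additional target for p = j.
  refine (Finset.card_le_card_of_injOn (t := insert (j, j, j) (patterns132 (w * swap i j)))
    (fun p => if p = j then (j, j, j) else (j, p, m)) ?_ ?_).trans (Finset.card_insert_le _ _)
  · intro p hp
    obtain ⟨h1, h2, h3⟩ := (Finset.mem_filter.1 hp).2
    dsimp only
    split_ifs with h
    · exact Finset.mem_insert_self _ _
    · have hjp := lt_of_le_of_ne (hmin p h1 h2 h3) (Ne.symm h)
      refine Finset.mem_insert_of_mem (mem_patterns132.2 ⟨hjp, h2, ?_⟩)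
      simp only [Perm.mul_apply, swap_apply_right, swap_apply_of_ne_of_ne h1.ne' h,
        swap_apply_of_ne_of_ne (h1.trans h2).ne' (hjp.trans h2).ne']
      exact ⟨hlt, h3⟩
  · intro p _ q _ hpq
    dsimp only at hpq
    split_ifs at hpq <;> simp_all

theorem eta_add_one_le_sum {w : Perm (Fin n)} {i : Fin n} (hw : DominatesBefore w i)
    (hi : ∃ l, i < l ∧ w i < w l) :
    eta w + 1 ≤ ∑ j ∈ upperCovers w i, (eta (w * swap i j) + 1) := by
  obtain ⟨l, hl⟩ := hi
  obtain ⟨m, hm, hmin⟩ := Finset.exists_min_image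
    (Finset.univ.filter fun l => i < l ∧ w i < w l) w ⟨l, by simpa using hl⟩
  simp only [Finset.mem_filter, Finset.mem_univ, true_and] at hm hmin
  obtain ⟨him, hlt⟩ := hm
  -- The value w m is least among larger entries right of i, and dominance puts all entries left of
  -- i above w m.
  have hadj : ∀ l, ¬ (w i < w l ∧ w l < w m) := by
    rintro l ⟨h1, h2⟩
    rcases lt_trichotomy l i with h | rfl | h
    · exact absurd h2 (hw l h m (h.trans him)).not_gt
    · exact lt_irrefl _ h1
    · exact absurd h2 (hmin l ⟨h, h1⟩).not_gt
  have hmem : m ∈ upperCovers w i := mem_upperCovers.2 ⟨him, hlt, fun l _ _ => hadj l⟩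
  have hle := eta_le_eta_mul_swap_add him hlt hadj
  rcases (Finset.univ.filter fun p => i < p ∧ p < m ∧ w m < w p).eq_empty_or_nonempty with h | h
  · rw [h, Finset.card_empty] at hle
    exact (Nat.succ_le_succ hle).trans
      (Finset.single_le_sum (f := fun j => eta (w * swap i j) + 1) (fun _ _ => Nat.zero_le _) hmem)
  · obtain ⟨j, hj, hjmin⟩ := Finset.exists_min_image _ id h
    simp only [Finset.mem_filter, Finset.mem_univ, true_and, id] at hj hjmin
    obtain ⟨hij, hjm, hwj⟩ := hj
    -- An entry between i and j with value in (w i, w j) would exceed w m by the choice of m,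
    -- contradicting that j is the first such position.
    have hjmem : j ∈ upperCovers w i := by
      refine mem_upperCovers.2 ⟨hij, hlt.trans hwj, fun l h1 h2 h3 => ?_⟩
      refine absurd (hjmin l ⟨h1, h2.trans hjm, ?_⟩) h2.not_ge
      exact lt_of_le_of_ne (hmin l ⟨h1, h3.1⟩) (w.injective.ne (h2.trans hjm).ne')
    have hle2 := card_le_eta_mul_swap_add_one hlt fun p h1 h2 h3 => hjmin p ⟨h1, h2, h3⟩
    have hsub : ({j, m} : Finset (Fin n)) ⊆ upperCovers w i := by
      simp [Finset.insert_subset_iff, hjmem, hmem]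
    have := Finset.sum_le_sum_of_subset (f := fun j => eta (w * swap i j) + 1) hsub
    rw [Finset.sum_pair hjm.ne] at this
    omega

/-- Rearrangement inequality. This measure suits exchanges of distant positions, whereas `nonInv_lt`
handles adjacent ones only. -/
theorem sum_mul_swap_lt {w : Perm (Fin n)} {i j : Fin n} (hij : i < j) (hw : w i < w j) :
    ∑ p : Fin n, (p : ℕ) * (w * swap i j) p < ∑ p : Fin n, (p : ℕ) * w p := by
  have h : ∀ f : Fin n → ℕ, ∑ p, f p = f i + (f j + ∑ p ∈ (Finset.univ.erase i).erase j, f p) :=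
    fun f => by rw [Finset.add_sum_erase _ _ (Finset.mem_erase.2 ⟨hij.ne', Finset.mem_univ j⟩),
      Finset.add_sum_erase _ _ (Finset.mem_univ i)]
  rw [h, h fun p : Fin n => (p : ℕ) * w p, Finset.sum_congr rfl fun p hp => by
    simp only [Finset.mem_erase] at hp
    rw [Perm.mul_apply, swap_apply_of_ne_of_ne hp.2.1 hp.1]]
  simp only [Perm.mul_apply, swap_apply_left, swap_apply_right]
  rw [Fin.lt_def] at hij hw
  nlinarith

end Bound

end Schubert

theorem theorem1 (n : ℕ) (w : Equiv.Perm (Fin n)) :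
    (Schubert.eta w : ℤ) + 1 ≤ Schubert.nu w := by
  induction hm : ∑ p : Fin n, (p : ℕ) * (w p : ℕ) using Nat.strong_induction_on generalizing w with
  | _ m ih =>
    subst hm
    by_cases hw : w = Fin.revPerm
    · rw [hw, Schubert.eta_revPerm, Schubert.nu_revPerm, Nat.cast_zero, zero_add]
    · obtain ⟨i, hdom, hi⟩ := Schubert.exists_dominatesBefore hw
      rw [Schubert.nu_eq_sum hdom hi]
      refine le_trans ?_ (Finset.sum_le_sum fun j hj =>
        have hj := Schubert.mem_upperCovers.1 hj
        ih _ (Schubert.sum_mul_swap_lt hj.1 hj.2.1) (w * Equiv.swap i j) rfl)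
      exact_mod_cast Schubert.eta_add_one_le_sum hdom hi
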